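/- Let $F$ be a field of characteristic different from $2$ (for instance $F=\mathbf Q,\mathbf R,\mathbf C$), let $V$ be a finite-dimensional $F$-vector space and $Q$ a non-degenerate quadratic form on $V$. Let $C(Q)$ be its Clifford algebra (with $v^2=Q(v)$ for $v\in V\subset C(Q)$) and $C^+(Q)$ its even part. Let $CSpin(Q)$ be the algebraic group over $F$ whose points in a commutative $F$-algebra $A$ are $$CSpin(Q)(A)=\{g\in (A\otimes_F C^+(Q))^*:\ g\,(A\otimes_F V)\,g^{-1}\subset A\otimes_F V\},$$ so that $CSpin(Q)(F)=\{g\in C^+(Q)^*: gVg^{-1}\subset V\}$, and let $\sigma(g)=[x\mapsto gx]$ be the spin representation of $CSpin(Q)$ on $C^+(Q)$. Then the map $$C^+(Q)^{op}\longrightarrow End_F(C^+(Q)),\qquad y\longmapsto[x\mapsto xy]$$ is an injective homomorphism of $F$-algebras whose image is exactly $$End_{CSpin(Q)}(C^+(Q))=\{M\in End_F(C^+(Q)):\ M\sigma(g)=\sigma(g)M\}.$$ This holds both when $g$ runs over the group $CSpin(Q)(F)$ and when commutation is required for the algebraic group, that is, after base change of $M$ to $A$, for all commutative $F$-algebras $A$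 and all $g\in CSpin(Q)(A)$. In particular $C^+(Q)\cong End_{CSpin(Q)}(C^+(Q))$ as $F$-algebras. -/

import Mathlib

open scoped TensorProduct

universe u v

namespace KugaSatake

variable {F : Type u} [Field F] {V : Type v} [AddCommGroup V] [Module F V]

/-- The even Clifford algebra `C⁺(Q)`. -/
abbrev CPlus (Q : QuadraticForm F V) : Type (max u v) := CliffordAlgebra.even Q

/-- `CSpin(Q) = {g ∈ C⁺(Q)ˣ : g V g⁻¹ ⊆ V}`, as a group of units (the group of `F`-points). -/
def CSpin [FiniteDimensional F V] (Q : QuadraticForm F V) : Subgroup (CPlus Q)ˣ where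
  carrier := {g | ∀ v : V,
    ((g : CPlus Q) : CliffordAlgebra Q) * CliffordAlgebra.ι Q v *
      (((g⁻¹ : (CPlus Q)ˣ) : CPlus Q) : CliffordAlgebra Q) ∈ LinearMap.range (CliffordAlgebra.ι Q)}
  one_mem' v := by simp
  mul_mem' := by
    intro g h hg hh v
    obtain ⟨w, hw⟩ := hh v
    have := hg w
    rw [hw] at this
    simpa [mul_assoc] using this
  inv_mem' := by
    intro g hg v
    -- conjugation by `g` is injective on the finite-dimensional space `V`, hence onto
    set a : CliffordAlgebra Q := ((g : CPlus Q) : CliffordAlgebra Q)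
    set b : CliffordAlgebra Q := (((g⁻¹ : (CPlus Q)ˣ) : CPlus Q) : CliffordAlgebra Q)
    have hba : b * a = 1 := congrArg Subtype.val g.inv_mul
    let c : CliffordAlgebra Q →ₗ[F] CliffordAlgebra Q :=
      LinearMap.mulRight F b ∘ₗ LinearMap.mulLeft F a
    have hc : ∀ x, b * c x * a = x := by
      intro x
      change b * (a * x * b) * a = x
      calc b * (a * x * b) * a = (b * a) * x * (b * a) := by simp only [mul_assoc]
        _ = x := by rw [hba, one_mul, mul_one]
    have hmem : ∀ x ∈ LinearMap.range (CliffordAlgebra.ι Q),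
        c x ∈ LinearMap.range (CliffordAlgebra.ι Q) := by
      rintro _ ⟨w, rfl⟩
      exact hg w
    have hinj : Function.Injective (c.restrict hmem) := by
      intro x y hxy
      have h : c x = c y := congrArg Subtype.val hxy
      apply Subtype.ext
      rw [← hc x, ← hc y, h]
    obtain ⟨y, hy⟩ := LinearMap.injective_iff_surjective.mp hinj
      ⟨CliffordAlgebra.ι Q v, LinearMap.mem_range_self _ v⟩
    have h : c y = CliffordAlgebra.ι Q v := congrArg Subtype.val hy
    change b * CliffordAlgebra.ι Q v * a ∈ _
    rw [← h, hc]
    exact y.2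

/-- The spin representation `σ(g) = [x ↦ g x]` of `CSpin(Q)` on `C⁺(Q)`. -/
def spinRep [FiniteDimensional F V] (Q : QuadraticForm F V) :
    Representation F (CSpin Q) (CPlus Q) where
  toFun g := LinearMap.mulLeft F ((g : (CPlus Q)ˣ) : CPlus Q)
  map_one' := by ext; simp
  map_mul' g h := by ext; simp

/-- The algebra `{M ∈ End(C⁺(Q)) : M σ(g) = σ(g) M}`, with `g` in the group of `F`-points. -/
def commutant [FiniteDimensional F V] (Q : QuadraticForm F V) :
    Subalgebra F (Module.End F (CPlus Q)) where
  carrier := {M | ∀ g : CSpin Q, M * spinRep Q g = spinRep Q g * M}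
  mul_mem' {M N} hM hN g := by rw [mul_assoc, hN g, ← mul_assoc, hM g, mul_assoc]
  add_mem' {M N} hM hN g := by rw [add_mul, mul_add, hM g, hN g]
  algebraMap_mem' r g := Algebra.commutes r _

/-- The inclusion `A ⊗ C⁺(Q) → A ⊗ C(Q)`. -/
noncomputable def inclA (A : Type u) [CommRing A] [Algebra F A] (Q : QuadraticForm F V) :
    (A ⊗[F] CPlus Q) →ₐ[A] (A ⊗[F] CliffordAlgebra Q) :=
  Algebra.TensorProduct.map (AlgHom.id A A) (CliffordAlgebra.even Q).val

/-- The points of the algebraic group `CSpin(Q)` with values in a commutative `F`-algebra `A`: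
the units `g` of `A ⊗ C⁺(Q)` with `g (A ⊗ V) g⁻¹ ⊆ A ⊗ V` inside `A ⊗ C(Q)`. (For `Q`
nondegenerate over a field with `2 ≠ 0`, such a `g` acts on `A ⊗ V` as an isometry, so that this
submonoid of the units is closed under inverses.) -/
def CSpinPoints (A : Type u) [CommRing A] [Algebra F A] (Q : QuadraticForm F V) :
    Submonoid (A ⊗[F] CPlus Q)ˣ where
  carrier := {g | ∀ x : A ⊗[F] V,
    inclA A Q g * (CliffordAlgebra.ι Q).baseChange A x *
      inclA A Q ((g⁻¹ : (A ⊗[F] CPlus Q)ˣ) : A ⊗[F] CPlus Q) ∈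
        LinearMap.range ((CliffordAlgebra.ι Q).baseChange A)}
  one_mem' x := by simp
  mul_mem' := by
    intro g h hg hh x
    obtain ⟨w, hw⟩ := hh x
    have := hg w
    rw [hw] at this
    simpa [mul_assoc] using this

/-- The endomorphisms `M` of the `F`-vector space `C⁺(Q)` that commute with the spin
representation of the algebraic group `CSpin(Q)`: for every commutative `F`-algebra `A`, the base
change of `M` to `A` commutes with left multiplication by each `A`-point. -/
def algCommutant (Q : QuadraticForm F V) : Subalgebra F (Module.End F (CPlus Q)) where
  carrier := {M | ∀ (A : Type u) [CommRing A] [Algebra F A], ∀ g ∈ CSpinPoints A Q,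
    M.baseChange A * LinearMap.mulLeft A (g : A ⊗[F] CPlus Q) =
      LinearMap.mulLeft A (g : A ⊗[F] CPlus Q) * M.baseChange A}
  mul_mem' {M N} hM hN A _ _ g hg := by
    have h : (M * N).baseChange A = M.baseChange A * N.baseChange A := LinearMap.baseChange_comp _ _
    rw [h, mul_assoc, hN A g hg, ← mul_assoc, hM A g hg, mul_assoc]
  add_mem' {M N} hM hN A _ _ g hg := by
    rw [LinearMap.baseChange_add, add_mul, mul_add, hM A g hg, hN A g hg]
  algebraMap_mem' r A _ _ g _ := by
    have h : (algebraMap F (Module.End F (CPlus Q)) r).baseChange A =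
        algebraMap A (Module.End A (A ⊗[F] CPlus Q)) (algebraMap F A r) := by
      ext x
      simp [TensorProduct.smul_tmul', Algebra.algebraMap_eq_smul_one]
    rw [h]
    exact Algebra.commutes _ _

/-- Right multiplication `y ↦ [x ↦ x y]`, an algebra homomorphism on the opposite algebra. -/
def rightMul (Q : QuadraticForm F V) : (CPlus Q)ᵐᵒᵖ →ₐ[F] Module.End F (CPlus Q) where
  toFun y := LinearMap.mulRight F y.unop
  map_one' := by ext; simp
  map_mul' y z := by ext; simp [mul_assoc]
  map_zero' := by ext; simp
  map_add' y z := by ext; simp [mul_add]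
  commutes' r := by
    ext x
    simp [Algebra.algebraMap_eq_smul_one]

end KugaSatake

namespace KugaSatake

open CliffordAlgebra

variable {F : Type u} [Field F] {V : Type v} [AddCommGroup V] [Module F V]

/-! The crux is that the `F`-points of `CSpin(Q)` already generate `C⁺(Q)` as an algebra.
Anisotropic vectors span `V`, so products `ab` of two of them, which are units in `CSpin(Q)`, span
all products of two vectors. An `M` commuting with these points is therefore left `C⁺(Q)`-linear, so
`M x = x M(1)`. Both commutants are then settled by a cycle of inclusions: right multiplications lie
in `algCommutant`, which lies in `commutant`, which consists of right multiplications. -/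

/-- Away from characteristic two, a nondegenerate quadratic space is spanned by its anisotropic
vectors. -/
theorem span_anisotropic_eq_top (h2 : (2 : F) ≠ 0) [FiniteDimensional F V]
    (Q : QuadraticForm F V) (hQ : (QuadraticMap.polarBilin Q).Nondegenerate) :
    Submodule.span F {v : V | Q v ≠ 0} = ⊤ := by
  have := invertibleOfNonzero h2
  have hsymm : (QuadraticMap.polarBilin Q).IsSymm :=
    ⟨fun x y => QuadraticMap.polar_comm Q x y⟩
  obtain ⟨b, hb⟩ := LinearMap.BilinForm.exists_orthogonal_basis hsymm
  -- An isotropic member of an orthogonal basis would lie in the radical.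
  have hne := hb.not_isOrtho_basis_self_of_separatingLeft hQ.1
  rw [eq_top_iff, ← b.span_eq, Submodule.span_le]
  rintro _ ⟨i, rfl⟩
  refine Submodule.subset_span fun h0 => hne i ?_
  simp [QuadraticMap.polar_self, h0]

/-- The product of two anisotropic vectors, as a unit of the even Clifford algebra. -/
def unitOfAnisotropic (Q : QuadraticForm F V) {a b : V} (ha : Q a ≠ 0) (hb : Q b ≠ 0) :
    (CPlus Q)ˣ where
  val := (even.ι Q).bilin a b
  inv := (Q a * Q b)⁻¹ • (even.ι Q).bilin b a
  val_inv := by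
    rw [mul_smul_comm, (even.ι Q).contract_mid, (even.ι Q).contract, Algebra.algebraMap_eq_smul_one,
      smul_smul, smul_smul, mul_assoc, mul_comm (Q b), inv_mul_cancel₀ (mul_ne_zero ha hb), one_smul]
  inv_val := by
    rw [smul_mul_assoc, (even.ι Q).contract_mid, (even.ι Q).contract,
      Algebra.algebraMap_eq_smul_one, smul_smul, smul_smul, mul_assoc, inv_mul_cancel₀ (mul_ne_zero ha hb),
      one_smul]

/-- The inverse of `ab` is a multiple of `ba`, and `v ↦ a(bvb)a` preserves `V` because each sandwich
`u v u` of vectors is again a vector. -/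
theorem unitOfAnisotropic_mem_CSpin [FiniteDimensional F V] (Q : QuadraticForm F V) {a b : V}
    (ha : Q a ≠ 0) (hb : Q b ≠ 0) : unitOfAnisotropic Q ha hb ∈ CSpin Q := by
  intro v
  change ι Q a * ι Q b * ι Q v * ((Q a * Q b)⁻¹ • (ι Q b * ι Q a)) ∈ _
  have h : ι Q a * ι Q b * ι Q v * (ι Q b * ι Q a) =
      ι Q a * (ι Q b * ι Q v * ι Q b) * ι Q a := by simp only [mul_assoc]
  rw [mul_smul_comm, h, ι_mul_ι_mul_ι, ι_mul_ι_mul_ι]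
  exact Submodule.smul_mem _ _ (LinearMap.mem_range_self _ _)

/-- The even Clifford algebra is generated, as an algebra, by `CSpin(Q)`. -/
theorem adjoin_CSpin_eq_top (h2 : (2 : F) ≠ 0) [FiniteDimensional F V]
    (Q : QuadraticForm F V) (hQ : (QuadraticMap.polarBilin Q).Nondegenerate) :
    Algebra.adjoin F ((fun g : (CPlus Q)ˣ => (g : CPlus Q)) '' (CSpin Q : Set (CPlus Q)ˣ)) = ⊤ := by
  set S := Algebra.adjoin F ((fun g : (CPlus Q)ˣ => (g : CPlus Q)) '' (CSpin Q : Set (CPlus Q)ˣ))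
  have hspan := span_anisotropic_eq_top h2 Q hQ
  have key : ∀ a b : V, (even.ι Q).bilin a b ∈ S := by
    intro a b
    have ha : a ∈ Submodule.span F {v : V | Q v ≠ 0} := hspan ▸ Submodule.mem_top
    have hb : b ∈ Submodule.span F {v : V | Q v ≠ 0} := hspan ▸ Submodule.mem_top
    induction ha, hb using Submodule.span_induction₂ with
    | mem_mem x y hx hy =>
      exact Algebra.subset_adjoin ⟨_, unitOfAnisotropic_mem_CSpin Q hx hy, rfl⟩
    | zero_left y _ => simp
    | zero_right x _ => simp
    | add_left x y z _ _ _ hx hy => simpa using add_mem hx hy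
    | add_right x y z _ _ _ hx hy => simpa using add_mem hx hy
    | smul_left r x y _ _ h => simpa using S.smul_mem h r
    | smul_right r x y _ _ h => simpa using S.smul_mem h r
  rw [eq_top_iff]
  rintro ⟨x, hx⟩ -
  refine even_induction (Q := Q) (motive := fun x hx => (⟨x, hx⟩ : CPlus Q) ∈ S)
    (fun r => S.algebraMap_mem r) (fun x y hx hy h h' => S.add_mem h h')
    (fun a b x hx h => S.mul_mem (key a b) h) x hx

theorem rightMul_injective (Q : QuadraticForm F V) : Function.Injective (rightMul Q) := by
  intro y z h
  have h1 : (1 : CPlus Q) * y.unop = 1 * z.unop := LinearMap.congr_fun h 1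
  exact MulOpposite.unop_injective (by simpa using h1)

theorem commutant_le_range_rightMul (h2 : (2 : F) ≠ 0) [FiniteDimensional F V]
    (Q : QuadraticForm F V) (hQ : (QuadraticMap.polarBilin Q).Nondegenerate) :
    commutant Q ≤ (rightMul Q).range := by
  intro M hM
  -- The `x` satisfying this for all `y` form a subalgebra; `y` stays quantified because the product
  -- case applies the hypothesis for `x` at `z * y`.
  have key : ∀ x y : CPlus Q, M (x * y) = x * M y := by
    intro x
    have hx : x ∈ Algebra.adjoin F
        ((fun g : (CPlus Q)ˣ => (g : CPlus Q)) '' (CSpin Q : Set (CPlus Q)ˣ)) := by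
      rw [adjoin_CSpin_eq_top h2 Q hQ]; trivial
    induction hx using Algebra.adjoin_induction with
    | mem x hx =>
      obtain ⟨g, hg, rfl⟩ := hx
      exact fun y => LinearMap.congr_fun (hM ⟨g, hg⟩) y
    | algebraMap r => intro y; simp [← Algebra.smul_def]
    | add x z _ _ hx hz => intro y; rw [add_mul, map_add, hx, hz, add_mul]
    | mul x z _ _ hx hz => intro y; rw [mul_assoc, hx, hz, mul_assoc]
  refine ⟨MulOpposite.op (M 1), LinearMap.ext fun x => ?_⟩
  change x * M 1 = M x
  rw [← key, mul_one]

/-- Base change turns right multiplication by `y` into right multiplication by `1 ⊗ y`;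
associativity does the rest. -/
theorem range_rightMul_le_algCommutant (Q : QuadraticForm F V) :
    (rightMul Q).range ≤ algCommutant Q := by
  rintro _ ⟨y, rfl⟩ A _ _ g -
  have h : (rightMul Q y).baseChange A = LinearMap.mulRight A ((1 : A) ⊗ₜ[F] y.unop) := by
    ext x
    simp [rightMul]
  refine LinearMap.ext fun x => ?_
  change (rightMul Q y).baseChange A (g * x) = g * (rightMul Q y).baseChange A x
  rw [h]
  exact mul_assoc _ _ _

/-- The `F`-points of `CSpin(Q)` give points of the algebraic group with values in any
`F`-algebra. -/
theorem map_mem_CSpinPoints [FiniteDimensional F V] (A : Type u) [CommRing A] [Algebra F A]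
    (Q : QuadraticForm F V) {g : (CPlus Q)ˣ} (hg : g ∈ CSpin Q) :
    Units.map (Algebra.TensorProduct.includeRight : CPlus Q →ₐ[F] A ⊗[F] CPlus Q) g ∈
      CSpinPoints A Q := by
  intro x
  induction x with
  | zero => simp
  | add x y hx hy => rw [map_add, mul_add, add_mul]; exact add_mem hx hy
  | tmul a v =>
    obtain ⟨w, hw⟩ := hg v
    exact ⟨a ⊗ₜ w, by simp [inclA, hw, ← map_inv]⟩

/-- Take `A = F` and identify `F ⊗ C⁺(Q)` with `C⁺(Q)`. -/
theorem algCommutant_le_commutant [FiniteDimensional F V] (Q : QuadraticForm F V) :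
    algCommutant Q ≤ commutant Q := by
  rintro M hM ⟨g, hg⟩
  refine LinearMap.ext fun x => ?_
  have h := LinearMap.congr_fun (hM F _ (map_mem_CSpinPoints F Q hg)) ((1 : F) ⊗ₜ x)
  have h' : (1 : F) ⊗ₜ[F] M (g * x) = (1 : F) ⊗ₜ[F] ((g : CPlus Q) * M x) := by
    simpa using h
  exact (TensorProduct.lid F (CPlus Q)).symm.injective h'

/-- Reversal, as an isomorphism of the even Clifford algebra with its opposite. -/
def evenReverseOp (Q : QuadraticForm F V) : CPlus Q ≃ₐ[F] (CPlus Q)ᵐᵒᵖ :=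
  AlgEquiv.ofLinearEquiv
    ((LinearEquiv.ofInvolutive
      ((reverse (Q := Q)).restrict (p := Subalgebra.toSubmodule (CliffordAlgebra.even Q))
        (q := Subalgebra.toSubmodule (CliffordAlgebra.even Q))
        fun _ hx => (reverse_mem_evenOdd_iff Q).mpr hx)
      fun x => Subtype.ext (reverse_reverse (x : CliffordAlgebra Q))).trans
        (MulOpposite.opLinearEquiv F))
    (MulOpposite.unop_injective (Subtype.ext reverse.map_one))
    fun _ _ => MulOpposite.unop_injective (Subtype.ext (reverse.map_mul _ _))

end KugaSatake

theorem lemma6p5 {F : Type u} [Field F] (h2 : (2 : F) ≠ 0)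
    {V : Type v} [AddCommGroup V] [Module F V] [FiniteDimensional F V]
    (Q : QuadraticForm F V) (hQ : (QuadraticMap.polarBilin Q).Nondegenerate) :
    Function.Injective (KugaSatake.rightMul Q) ∧
    (KugaSatake.rightMul Q).range = KugaSatake.commutant Q ∧
    (KugaSatake.rightMul Q).range = KugaSatake.algCommutant Q ∧
    Nonempty (CliffordAlgebra.even Q ≃ₐ[F] KugaSatake.commutant Q) := by
  have hinj := KugaSatake.rightMul_injective Q
  have hle := KugaSatake.range_rightMul_le_algCommutant Q
  have hle' := KugaSatake.algCommutant_le_commutant Q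
  have hge := KugaSatake.commutant_le_range_rightMul h2 Q hQ
  have hrange := le_antisymm (hle.trans hle') hge
  exact ⟨hinj, hrange, le_antisymm hle (hle'.trans hge),
    -- Reversal removes the `op` on the source of `rightMul`.
    ⟨((KugaSatake.evenReverseOp Q).trans (AlgEquiv.ofInjective _ hinj)).trans
      (Subalgebra.equivOfEq _ _ hrange)⟩⟩
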